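/- Let $(\Omega,\Sigma,\mu)$ be a finite measure space, $Z$ a real Banach space, and $X\subseteq Z^*$ a norm-closed subspace which is norming for $Z$, i.e. $|||z|||=\sup\{\langle x,z\rangle : x\in X,\ \|x\|\le 1\}$ defines an equivalent norm on $Z$. Let $\sigma(Z,X)$ be the topology on $Z$ of pointwise convergence on $X$. Let $\nu:\Sigma\to Z^*$ be a (norm-)countably additive vector measure which is $\mu$-continuous, i.e. $\|\nu(A)\|\to 0$ as $\mu(A)\to 0$, and suppose that $$\overline{\mathrm{co}\Big\{\tfrac{\nu(B)}{\mu(B)} : B\in\Sigma,\ B\subseteq A,\ \mu(B)>0\Big\}}^{\,w^*}\cap X\neq\emptyset\quad\text{for every } A\in\Sigma \text{ with } \mu(A)>0. \tag{G}$$ Let $K\subseteq Z$ be a set whose convex hull $\mathrm{co}(K)$ is relatively convex block compact in $(Z,\sigma(Z,X))$, i.e. every sequence $(g_n)_{n\in\mathbb N}$ in $\mathrm{co}(K)$ admits a sequence of the form $h_k=\sum_{n\in I_k}a_n g_n$ ($k\in\mathbb N$) which $\sigma(Z,X)$-converges to some element of $Z$, where the $I_k$ are finite subsets of $\mathbb N$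 with $\max(I_k)<\min(I_{k+1})$, $a_n\ge 0$ for all $n$, and $\sum_{n\in I_k}a_n=1$ for all $k$. Then for every $B\in\Sigma$ the restriction $\nu(B)|_K$ is $\sigma(Z,X)$-continuous. -/

import Mathlib

open MeasureTheory Filter Topology

noncomputable section

/-- `h` is a convex block subsequence of `g`: `h k = ∑ n ∈ I k, a n • g n` with finite blocks `I k`
such that `max (I k) < min (I (k + 1))`, `a n ≥ 0` and `∑ n ∈ I k, a n = 1`
(so that every block is non-empty). -/
def IsConvexBlockSubseq {E : Type*} [AddCommGroup E] [Module ℝ E] (h g : ℕ → E) : Prop :=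
  ∃ (I : ℕ → Finset ℕ) (a : ℕ → ℝ),
    (∀ k, ∀ i ∈ I k, ∀ j ∈ I (k + 1), i < j) ∧
    (∀ n, 0 ≤ a n) ∧
    (∀ k, ∑ n ∈ I k, a n = 1) ∧
    ∀ k, h k = ∑ n ∈ I k, a n • g n

/-- `S` is relatively convex block compact for the topology `t`: every sequence in `S` has a
convex block subsequence that converges to some point of the space. -/
def IsRelConvexBlockCompact {E : Type*} [AddCommGroup E] [Module ℝ E]
    (t : TopologicalSpace E) (S : Set E) : Prop :=
  ∀ g : ℕ → E, (∀ n, g n ∈ S) →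
    ∃ h : ℕ → E, IsConvexBlockSubseq h g ∧ ∃ l : E, Tendsto h atTop (@nhds E t l)

section DualPair

variable {Z : Type*} [NormedAddCommGroup Z] [NormedSpace ℝ Z]

/-- The bilinear pairing `(z, x) ↦ ⟨x, z⟩` of `Z` with a subspace `X` of its dual. -/
def dualPairing (X : Submodule ℝ (StrongDual ℝ Z)) : Z →ₗ[ℝ] X →ₗ[ℝ] ℝ :=
  LinearMap.mk₂ ℝ (fun (z : Z) (x : X) => (x : StrongDual ℝ Z) z)
    (fun z₁ z₂ x => by simp) (fun c z x => by simp) (fun z x₁ x₂ => by simp)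
    (fun c z x => by simp)

/-- The topology `σ(Z, X)` on `Z`: pointwise convergence on `X`. -/
@[reducible] def sigmaTopology (X : Submodule ℝ (StrongDual ℝ Z)) : TopologicalSpace Z :=
  inferInstanceAs (TopologicalSpace (WeakBilin (dualPairing X)))

/-- The topology `σ(Z, X)` is the topology of pointwise convergence on `X`. -/
theorem sigmaTopology_eq (X : Submodule ℝ (StrongDual ℝ Z)) :
    sigmaTopology X =
      TopologicalSpace.induced (fun (z : Z) (x : X) => (x : StrongDual ℝ Z) z)
        Pi.topologicalSpace :=
  rfl

/-- `|||z||| = sup {⟨x, z⟩ : x ∈ B_X}`. -/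
def supNormOn (X : Submodule ℝ (StrongDual ℝ Z)) (z : Z) : ℝ :=
  sSup ((fun x : StrongDual ℝ Z => x z) '' {x | x ∈ X ∧ ‖x‖ ≤ 1})

/-- `X` is norming for `Z`: `|||·|||` is equivalent to the norm of `Z`. -/
def IsNorming (X : Submodule ℝ (StrongDual ℝ Z)) : Prop :=
  ∃ a b : ℝ, 0 < a ∧ 0 < b ∧
    ∀ z : Z, a * ‖z‖ ≤ supNormOn X z ∧ supNormOn X z ≤ b * ‖z‖

variable {Ω : Type*} [MeasurableSpace Ω]

/-- `ν` is `μ`-continuous: `‖ν A‖ → 0` as `μ A → 0`. -/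
def IsContinuousWrt (ν : VectorMeasure Ω (StrongDual ℝ Z)) (μ : Measure Ω) : Prop :=
  ∀ ε : ℝ, 0 < ε → ∃ δ : ℝ, 0 < δ ∧
    ∀ A : Set Ω, MeasurableSet A → μ.real A < δ → ‖ν A‖ < ε

/-- The average range `{ν B / μ B : B measurable, B ⊆ A, μ B > 0}`. -/
def averageRange (μ : Measure Ω) (ν : VectorMeasure Ω (StrongDual ℝ Z)) (A : Set Ω) :
    Set (StrongDual ℝ Z) :=
  {y | ∃ B : Set Ω, MeasurableSet B ∧ B ⊆ A ∧ 0 < μ B ∧ y = (μ.real B)⁻¹ • ν B}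

/-- Condition (G): for every measurable `A` with `μ A > 0`, the weak-star closure of the convex
hull of the average range of `ν` on `A` meets `X`. -/
def ConditionG (μ : Measure Ω) (ν : VectorMeasure Ω (StrongDual ℝ Z))
    (X : Submodule ℝ (StrongDual ℝ Z)) : Prop :=
  ∀ A : Set Ω, MeasurableSet A → 0 < μ A →
    ∃ x ∈ X, StrongDual.toWeakDual x ∈
      closure ((StrongDual.toWeakDual : StrongDual ℝ Z → WeakDual ℝ Z) ''
        convexHull ℝ (averageRange μ ν A))

end DualPair

end

/-! ### Convex block subsequences -/

/-! Radon-Nikodym turns `ν` into a bounded operator `T : Z → L¹(μ)` with `ν B z = ∫_B T z`. The set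
`co K` is norm bounded (uniform boundedness on `X`), so `T (co K)` is uniformly integrable.

If continuity failed at `z₀`, then `z₀` would be in the `σ(Z, X)`-closure of a convex set `C ⊆ co K`
on which `±(ν B z - ν B z₀) ≥ ε`. Block compactness concerns sequences, while this closure point is
given by a filter. The bridge is to minimise the strictly convex energy `∫ √(1 + f²)` of `T z` near
`z₀` within `C`: midpoints of near-minimisers stay in the convex neighbourhood, so uniform convexity
on uniformly integrable sets (`exists_sqrtEnergy_modulus`) makes `T` converge in norm to some `F`
along a finer filter (`exists_filter_tendsto`).

It remains to see that `F = T z₀`, for then `ν B z` tends to `ν B z₀` along that filter. Otherwise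
the two densities have a gap on a set `A`, and (G) supplies `x ∈ X` that preserves bounds of
densities on `A`. Choose a sequence in `co K` with `T g n → F` and `x (g n) → x z₀`, and pass to
convex blocks with `σ(Z, X)`-limit `l`. Then `x l = x z₀`, and a sequential closed graph argument
(Egorov and (G)) yields `F = T l`, so `x` must separate `l` from `z₀`: a contradiction. -/

theorem IsConvexBlockSubseq.le_of_mem {I : ℕ → Finset ℕ} {a : ℕ → ℝ}
    (hI : ∀ k, ∀ i ∈ I k, ∀ j ∈ I (k + 1), i < j) (ha : ∀ k, ∑ n ∈ I k, a n = 1)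
    (k : ℕ) : ∀ j ∈ I k, k ≤ j := by
  induction k with
  | zero => intro j _; exact Nat.zero_le j
  | succ k ih =>
    intro j hj
    have hne : (I k).Nonempty := by
      rw [Finset.nonempty_iff_ne_empty]
      intro h
      have := ha k
      simp [h] at this
    obtain ⟨i, hi⟩ := hne
    have := ih i hi
    have := hI k i hi j hj
    omega

theorem IsConvexBlockSubseq.map {E F : Type*} [AddCommGroup E] [Module ℝ E] [AddCommGroup F]
    [Module ℝ F] {h g : ℕ → E} (hb : IsConvexBlockSubseq h g) (L : E →ₗ[ℝ] F) :
    IsConvexBlockSubseq (fun n => L (h n)) (fun n => L (g n)) := by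
  obtain ⟨I, a, h1, h2, h3, h4⟩ := hb
  refine ⟨I, a, h1, h2, h3, fun k => ?_⟩
  simp [h4 k]

theorem IsConvexBlockSubseq.eventually_mem {E : Type*} [AddCommGroup E] [Module ℝ E]
    {h g : ℕ → E} (hb : IsConvexBlockSubseq h g) {s : Set E} (hs : Convex ℝ s) {N : ℕ}
    (hg : ∀ n, N ≤ n → g n ∈ s) : ∀ k, N ≤ k → h k ∈ s := by
  obtain ⟨I, a, h1, h2, h3, h4⟩ := hb
  intro k hk
  rw [h4 k]
  exact hs.sum_mem (fun i _ => h2 i) (h3 k)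
    fun i hi => hg i (hk.trans (IsConvexBlockSubseq.le_of_mem h1 h3 k i hi))

theorem IsConvexBlockSubseq.tendsto {E : Type*} [NormedAddCommGroup E] [NormedSpace ℝ E]
    {h g : ℕ → E} (hb : IsConvexBlockSubseq h g) {l : E} (hg : Tendsto g atTop (𝓝 l)) :
    Tendsto h atTop (𝓝 l) := by
  rw [Metric.tendsto_atTop] at hg ⊢
  intro ε hε
  obtain ⟨N, hN⟩ := hg ε hε
  exact ⟨N, hb.eventually_mem (convex_ball l ε) hN⟩

/-! ### A uniform convexity estimate on uniformly integrable sets -/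

/-- The second derivative of `√(1 + t²)` is `(1 + t²)^(-3/2)`, at least `(1 + R)⁻³` on `[-R, R]`;
this is the resulting quantitative midpoint convexity. -/
theorem sq_sub_le_deficit {a b R : ℝ} (ha : |a| ≤ R) (hb : |b| ≤ R) :
    (a - b) ^ 2 ≤ 4 * (1 + R) ^ 3 *
      (√(1 + a ^ 2) + √(1 + b ^ 2) - 2 * √(1 + ((a + b) / 2) ^ 2)) := by
  have hR : 0 ≤ R := (abs_nonneg a).trans ha
  have bound : ∀ x : ℝ, |x| ≤ R → √(1 + x ^ 2) ≤ 1 + R := by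
    intro x hx
    rw [Real.sqrt_le_left (by linarith)]
    have := sq_le_sq' (abs_le.1 hx).1 (abs_le.1 hx).2
    nlinarith
  -- The first term is the tangent line at `m`, evaluated at `x`; the second is the quadratic
  -- remainder.
  have key : ∀ x m : ℝ, |x| ≤ R → |m| ≤ R →
      (1 + x * m) / √(1 + m ^ 2) + (x - m) ^ 2 / (2 * (1 + R) ^ 3) ≤ √(1 + x ^ 2) := by
    intro x m hx hm
    have hx' := bound x hx
    have hm' := bound m hm
    have hpx : 0 < √(1 + x ^ 2) := Real.sqrt_pos.2 (by positivity)
    have hpm : 0 < √(1 + m ^ 2) := Real.sqrt_pos.2 (by positivity)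
    have sx : √(1 + x ^ 2) ^ 2 = 1 + x ^ 2 := Real.sq_sqrt (by positivity)
    have sm : √(1 + m ^ 2) ^ 2 = 1 + m ^ 2 := Real.sq_sqrt (by positivity)
    generalize √(1 + x ^ 2) = p at *
    generalize √(1 + m ^ 2) = q at *
    have hle : 1 + x * m ≤ p * q := by
      refine le_of_sq_le_sq ?_ (by positivity)
      nlinarith [sq_nonneg (x - m)]
    have hmain : (x - m) ^ 2 ≤ (p * q - (1 + x * m)) * (2 * (p * q)) := by
      have : (p * q) ^ 2 - (1 + x * m) ^ 2 = (x - m) ^ 2 := by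
        rw [mul_pow, sx, sm]; ring
      nlinarith
    have hq3 : 2 * (p * q) * q ≤ 2 * (1 + R) ^ 3 := by
      have : p * q ≤ (1 + R) * (1 + R) := by gcongr
      have : p * q * q ≤ (1 + R) * (1 + R) * (1 + R) := by gcongr
      nlinarith
    have h1 : (x - m) ^ 2 / (2 * (1 + R) ^ 3) ≤ (x - m) ^ 2 / (2 * (p * q) * q) := by
      gcongr
    have h2 : (x - m) ^ 2 / (2 * (p * q) * q) ≤ (p * q - (1 + x * m)) / q := by
      rw [div_le_div_iff₀ (by positivity) hpm]
      nlinarith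
    have h3 : (p * q - (1 + x * m)) / q = p - (1 + x * m) / q := by
      field_simp
    linarith
  set m := (a + b) / 2 with hm
  have hmR : |m| ≤ R := by
    rw [abs_le] at *
    constructor <;> linarith
  have h1 := key a m ha hmR
  have h2 := key b m hb hmR
  have hpm : 0 < √(1 + m ^ 2) := Real.sqrt_pos.2 (by positivity)
  have sm : √(1 + m ^ 2) ^ 2 = 1 + m ^ 2 := Real.sq_sqrt (by positivity)
  have h3 : (1 + a * m) / √(1 + m ^ 2) + (1 + b * m) / √(1 + m ^ 2) = 2 * √(1 + m ^ 2) := by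
    rw [← add_div, div_eq_iff hpm.ne', mul_assoc, ← sq, sm, hm]
    ring
  have h4 : (a - m) ^ 2 / (2 * (1 + R) ^ 3) + (b - m) ^ 2 / (2 * (1 + R) ^ 3)
      = (a - b) ^ 2 / (4 * (1 + R) ^ 3) := by
    rw [hm]; field_simp; ring
  have h5 : (a - b) ^ 2 / (4 * (1 + R) ^ 3) ≤
      √(1 + a ^ 2) + √(1 + b ^ 2) - 2 * √(1 + m ^ 2) := by linarith
  rw [div_le_iff₀ (by positivity)] at h5
  linarith

theorem deficit_nonneg (a b : ℝ) :
    0 ≤ √(1 + a ^ 2) + √(1 + b ^ 2) - 2 * √(1 + ((a + b) / 2) ^ 2) := by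
  have h := sq_sub_le_deficit (le_max_left |a| |b|) (le_max_right |a| |b|)
  have hp : 0 < 4 * (1 + max |a| |b|) ^ 3 := by positivity
  exact nonneg_of_mul_nonneg_right ((sq_nonneg _).trans h) hp

section

variable {Ω : Type*} [MeasurableSpace Ω] {μ : Measure Ω}

/-- The strictly convex functional `f ↦ ∫ √(1 + f²)` on `L¹(μ)`. -/
noncomputable def sqrtEnergy (f : Lp ℝ 1 μ) : ℝ := ∫ ω, √(1 + f ω ^ 2) ∂μ

theorem sqrt_one_add_sq_le (t : ℝ) : √(1 + t ^ 2) ≤ 1 + |t| := by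
  rw [Real.sqrt_le_left (by positivity)]
  nlinarith [abs_nonneg t, sq_abs t]

theorem sqrtEnergy_nonneg (f : Lp ℝ 1 μ) : 0 ≤ sqrtEnergy f :=
  integral_nonneg fun _ => Real.sqrt_nonneg _

variable [IsFiniteMeasure μ]

theorem integrable_sqrt_one_add_sq {f : Ω → ℝ} (hf : Integrable f μ) :
    Integrable (fun ω => √(1 + f ω ^ 2)) μ := by
  refine ((integrable_const (1 : ℝ)).add hf.abs).mono' ?_ ?_
  · exact (Real.continuous_sqrt.comp
      (continuous_const.add (continuous_pow 2))).comp_aestronglyMeasurable hf.1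
  · refine Eventually.of_forall fun ω => ?_
    rw [Real.norm_of_nonneg (Real.sqrt_nonneg _)]
    exact sqrt_one_add_sq_le _

theorem sqrtEnergy_le (f : Lp ℝ 1 μ) : sqrtEnergy f ≤ μ.real Set.univ + ‖f‖ := by
  have hf : Integrable f μ := L1.integrable_coeFn f
  calc sqrtEnergy f ≤ ∫ ω, (1 + ‖f ω‖) ∂μ :=
        integral_mono (integrable_sqrt_one_add_sq hf) ((integrable_const _).add hf.norm)
          fun ω => sqrt_one_add_sq_le _
    _ = μ.real Set.univ + ‖f‖ := by
        rw [integral_add (integrable_const _) hf.norm, L1.norm_eq_integral_norm]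
        simp

/-- Chebyshev makes the set where `|f|` or `|g|` is at least `R` small, and uniform integrability
controls `f - g` there. Elsewhere the pointwise convexity deficit, whose constant depends only on
`R`, controls `f - g`. -/
theorem exists_sqrtEnergy_modulus {S : Set (Lp ℝ 1 μ)} {M : ℝ} (hM : ∀ f ∈ S, ‖f‖ ≤ M)
    (hUI : ∀ ε : ℝ, 0 < ε → ∃ δ : ℝ, 0 < δ ∧ ∀ f ∈ S, ∀ A : Set Ω, MeasurableSet A →
      μ.real A < δ → ∫ ω in A, |f ω| ∂μ ≤ ε) {ε : ℝ} (hε : 0 < ε) :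
    ∃ δ : ℝ, 0 < δ ∧ ∀ f ∈ S, ∀ g ∈ S,
      sqrtEnergy f + sqrtEnergy g - 2 * sqrtEnergy ((2⁻¹ : ℝ) • (f + g)) ≤ δ → ‖f - g‖ ≤ ε := by
  obtain ⟨δ₀, hδ₀, hUI⟩ := hUI (ε / 8) (by positivity)
  -- The `+ 1` keeps the denominator positive when `μ = 0`.
  set η := ε / (4 * (μ.real Set.univ + 1)) with hηdef
  have hη : 0 < η := by positivity
  have hημ : η * μ.real Set.univ ≤ ε / 4 := by
    have : η * (μ.real Set.univ + 1) = ε / 4 := by rw [hηdef]; field_simp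
    nlinarith
  obtain ⟨R, hR0, hR⟩ : ∃ R : ℝ, 0 < R ∧ ∀ f ∈ S, μ.real {ω | R ≤ |f ω|} < δ₀ / 2 := by
    refine ⟨(|M| + 1) / (δ₀ / 2), by positivity, fun f hf => ?_⟩
    have hint : Integrable f μ := L1.integrable_coeFn f
    have h1 := mul_meas_ge_le_integral_of_nonneg (μ := μ) (f := fun ω => |f ω|)
      (Eventually.of_forall fun _ => abs_nonneg _) hint.abs ((|M| + 1) / (δ₀ / 2))
    have h2 : ∫ ω, |f ω| ∂μ < |M| + 1 := by
      have := L1.norm_eq_integral_norm f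
      simp only [Real.norm_eq_abs] at this
      rw [← this]
      linarith [hM f hf, le_abs_self M]
    have h3 := h1.trans_lt h2
    rw [div_mul_eq_mul_div, div_lt_iff₀ (by positivity)] at h3
    exact lt_of_mul_lt_mul_left h3 (by positivity)
  set C := 4 * (1 + R) ^ 3 with hC
  have hCpos : 0 < C := by positivity
  refine ⟨η * ε / (4 * C), by positivity, fun f hf g hg hD => ?_⟩
  have hfi : Integrable f μ := L1.integrable_coeFn f
  have hgi : Integrable g μ := L1.integrable_coeFn g
  set d : Ω → ℝ := fun ω =>
    √(1 + f ω ^ 2) + √(1 + g ω ^ 2) - 2 * √(1 + ((f ω + g ω) / 2) ^ 2) with hd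
  have hmi : Integrable (fun ω => (f ω + g ω) / 2) μ := (hfi.add hgi).div_const 2
  have hdi : Integrable d μ :=
    ((integrable_sqrt_one_add_sq hfi).add (integrable_sqrt_one_add_sq hgi)).sub
      ((integrable_sqrt_one_add_sq hmi).const_mul 2)
  have hDd : ∫ ω, d ω ∂μ ≤ η * ε / (4 * C) := by
    refine le_of_eq_of_le ?_ hD
    have hmid : sqrtEnergy ((2⁻¹ : ℝ) • (f + g)) = ∫ ω, √(1 + ((f ω + g ω) / 2) ^ 2) ∂μ := by
      refine integral_congr_ae ?_
      filter_upwards [Lp.coeFn_smul (2⁻¹ : ℝ) (f + g), Lp.coeFn_add f g] with ω h1 h2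
      simp only [h1, Pi.smul_apply, h2, Pi.add_apply, smul_eq_mul]
      congr 3
      ring
    have h1 : ∫ ω, d ω ∂μ = ∫ ω, (√(1 + f ω ^ 2) + √(1 + g ω ^ 2)) ∂μ -
        ∫ ω, 2 * √(1 + ((f ω + g ω) / 2) ^ 2) ∂μ :=
      integral_sub ((integrable_sqrt_one_add_sq hfi).add (integrable_sqrt_one_add_sq hgi))
        ((integrable_sqrt_one_add_sq hmi).const_mul 2)
    rw [hmid, h1, integral_const_mul,
      integral_add (integrable_sqrt_one_add_sq hfi) (integrable_sqrt_one_add_sq hgi)]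
    rfl
  set A : Set Ω := {ω | R ≤ |f ω|} ∪ {ω | R ≤ |g ω|} with hA
  have hAm : MeasurableSet A :=
    (measurableSet_le measurable_const (Lp.stronglyMeasurable f).measurable.abs).union
      (measurableSet_le measurable_const (Lp.stronglyMeasurable g).measurable.abs)
  have hAμ : μ.real A < δ₀ := by
    have := measureReal_union_le (μ := μ) {ω | R ≤ |f ω|} {ω | R ≤ |g ω|}
    linarith [hR f hf, hR g hg]
  have hnorm : ‖f - g‖ = ∫ ω, |f ω - g ω| ∂μ := by
    rw [L1.norm_eq_integral_norm]
    refine integral_congr_ae ?_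
    filter_upwards [Lp.coeFn_sub f g] with ω h
    rw [h, Pi.sub_apply, Real.norm_eq_abs]
  have hfg : Integrable (fun ω => |f ω - g ω|) μ := (hfi.sub hgi).abs
  have hon : ∫ ω in A, |f ω - g ω| ∂μ ≤ ε / 4 := by
    have h1 : ∫ ω in A, |f ω - g ω| ∂μ ≤ ∫ ω in A, (|f ω| + |g ω|) ∂μ :=
      setIntegral_mono hfg.integrableOn (hfi.abs.add hgi.abs).integrableOn fun ω => abs_sub _ _
    rw [integral_add hfi.abs.integrableOn hgi.abs.integrableOn] at h1
    linarith [hUI f hf A hAm hAμ, hUI g hg A hAm hAμ]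
  have hpos : ∀ ω, 0 ≤ η + C / η * d ω := fun ω => by
    have := deficit_nonneg (f ω) (g ω)
    positivity
  have hIi : Integrable (fun ω => η + C / η * d ω) μ :=
    (integrable_const η).add (hdi.const_mul _)
  have hoff : ∫ ω in Aᶜ, |f ω - g ω| ∂μ ≤ ε / 2 := by
    calc ∫ ω in Aᶜ, |f ω - g ω| ∂μ ≤ ∫ ω in Aᶜ, (η + C / η * d ω) ∂μ := by
          refine setIntegral_mono_on hfg.integrableOn hIi.integrableOn hAm.compl fun ω hω => ?_
          simp only [hA, Set.compl_union, Set.mem_inter_iff, Set.mem_compl_iff,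
            Set.mem_ofPred_eq, not_le] at hω
          have h1 : (f ω - g ω) ^ 2 ≤ C * d ω := sq_sub_le_deficit hω.1.le hω.2.le
          -- Young's inequality `η |u| ≤ η² + u²` trades the quadratic estimate for a linear one.
          have h2 : η * |f ω - g ω| ≤ η * (η + C / η * d ω) := by
            have : η * (η + C / η * d ω) = η ^ 2 + C * d ω := by field_simp
            rw [this]
            nlinarith [sq_nonneg (η - |f ω - g ω|), sq_abs (f ω - g ω), sq_nonneg η]
          exact le_of_mul_le_mul_left h2 hη
      _ ≤ ∫ ω, (η + C / η * d ω) ∂μ := setIntegral_le_integral hIi (Eventually.of_forall hpos)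
      _ = η * μ.real Set.univ + C / η * ∫ ω, d ω ∂μ := by
          rw [integral_add (integrable_const η) (hdi.const_mul _), integral_const_mul]
          simp [mul_comm]
      _ ≤ ε / 4 + C / η * (η * ε / (4 * C)) := by gcongr
      _ = ε / 2 := by field_simp; norm_num
  rw [hnorm, ← integral_add_compl hAm hfg]
  linarith

end

/-! ### The topology `σ(Z, X)` -/

section

variable {Z : Type*} [NormedAddCommGroup Z] [NormedSpace ℝ Z]

theorem exists_convex_nhds_sigma (X : Submodule ℝ (StrongDual ℝ Z)) {z : Z} {s : Set Z}
    (hs : s ∈ @nhds Z (sigmaTopology X) z) :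
    ∃ U ∈ @nhds Z (sigmaTopology X) z, Convex ℝ U ∧ U ⊆ s := by
  let L : Z →ₗ[ℝ] (X → ℝ) := LinearMap.pi fun x : X => ((x : StrongDual ℝ Z) : Z →ₗ[ℝ] ℝ)
  have hnhds : @nhds Z (sigmaTopology X) z = comap L (𝓝 (L z)) := by
    rw [sigmaTopology_eq, nhds_induced]
    rfl
  rw [hnhds] at hs ⊢
  obtain ⟨V, hV, hVs⟩ := hs
  obtain ⟨W, ⟨hW, hWc⟩, hWV⟩ :=
    (LocallyConvexSpace.convex_basis (𝕜 := ℝ) (L z)).mem_iff.1 hV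
  exact ⟨L ⁻¹' W, preimage_mem_comap hW, hWc.linear_preimage L,
    (Set.preimage_mono hWV).trans hVs⟩

theorem tendsto_apply_sigma (X : Submodule ℝ (StrongDual ℝ Z)) {x : StrongDual ℝ Z} (hx : x ∈ X)
    (z : Z) : Tendsto (fun y : Z => x y) (@nhds Z (sigmaTopology X) z) (𝓝 (x z)) := by
  rw [sigmaTopology_eq, nhds_induced]
  exact ((continuous_apply (A := fun _ : X => ℝ) (⟨x, hx⟩ : X)).tendsto _).comp tendsto_comap

/-- A relatively convex block compact set is bounded above on every element of `X`. -/
theorem IsRelConvexBlockCompact.exists_apply_le {X : Submodule ℝ (StrongDual ℝ Z)} {S : Set Z}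
    (hS : IsRelConvexBlockCompact (sigmaTopology X) S) {x : StrongDual ℝ Z} (hx : x ∈ X) :
    ∃ C : ℝ, ∀ z ∈ S, x z ≤ C := by
  by_contra! hcon
  choose g hgS hg using fun n : ℕ => hcon n
  obtain ⟨h, hb, l, hl⟩ := hS g hgS
  have hlim : Tendsto (fun n => x (h n)) atTop (𝓝 (x l)) :=
    (tendsto_apply_sigma X hx l).comp hl
  -- The `k`-th block uses only indices `n ≥ k`, where `x (g n) > n ≥ k`, so averaging cannot undo
  -- the growth.
  have hle : ∀ k : ℕ, (k : ℝ) ≤ x (h k) := fun k =>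
    (hb.map (x : Z →ₗ[ℝ] ℝ)).eventually_mem (convex_Ici (k : ℝ)) (N := k)
      (fun n hn => (Nat.cast_le.2 hn).trans (hg n).le) k le_rfl
  exact not_tendsto_nhds_of_tendsto_atTop
    (tendsto_atTop_mono hle tendsto_natCast_atTop_atTop) _ hlim

/-- Uniform boundedness on a closed subspace. -/
theorem exists_abs_le_of_pointwise_bounded {E ι : Type*} [NormedAddCommGroup E] [NormedSpace ℝ E]
    [CompleteSpace E] {X : Submodule ℝ E} (hX : IsClosed (X : Set E)) (φ : ι → StrongDual ℝ E)
    (h : ∀ x ∈ X, ∃ C, ∀ i, |φ i x| ≤ C) : ∃ C, ∀ i, ∀ x ∈ X, |φ i x| ≤ C * ‖x‖ := by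
  have : CompleteSpace X := hX.completeSpace_coe
  obtain ⟨C, hC⟩ := banach_steinhaus (g := fun i => (φ i).comp X.subtypeL)
    fun x : X => h x x.2
  exact ⟨C, fun i x hx => (((φ i).comp X.subtypeL).le_opNorm ⟨x, hx⟩).trans
    (mul_le_mul_of_nonneg_right (hC i) (norm_nonneg _))⟩

/-- Elements of `S` act as pointwise bounded functionals on `X`, which is complete because it is
closed. Banach-Steinhaus bounds them uniformly, and norming transfers the bound to the norm of `Z`.
-/
theorem IsRelConvexBlockCompact.exists_norm_le {X : Submodule ℝ (StrongDual ℝ Z)}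
    (hX : IsClosed (X : Set (StrongDual ℝ Z))) (hXn : IsNorming X) {S : Set Z}
    (hS : IsRelConvexBlockCompact (sigmaTopology X) S) :
    ∃ M : ℝ, 0 ≤ M ∧ ∀ z ∈ S, ‖z‖ ≤ M := by
  have hbdd : ∀ x ∈ X, ∃ C, ∀ z : S, |ContinuousLinearMap.apply ℝ ℝ (z : Z) x| ≤ C := by
    intro x hx
    obtain ⟨C₁, h₁⟩ := hS.exists_apply_le hx
    obtain ⟨C₂, h₂⟩ := hS.exists_apply_le (X.neg_mem hx)
    refine ⟨max C₁ C₂, fun z => abs_le.2 ⟨?_, (h₁ z z.2).trans (le_max_left _ _)⟩⟩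
    have := h₂ z z.2
    rw [neg_apply] at this
    change -max C₁ C₂ ≤ x z
    linarith [le_max_right C₁ C₂]
  obtain ⟨C, hC⟩ := exists_abs_le_of_pointwise_bounded hX
    (fun z : S => ContinuousLinearMap.apply ℝ ℝ (z : Z)) hbdd
  obtain ⟨a, b, ha, -, hab⟩ := hXn
  refine ⟨max C 0 / a, by positivity, fun z hz => ?_⟩
  rw [le_div_iff₀ ha, mul_comm]
  refine (hab z).1.trans (Real.sSup_le ?_ (le_max_right _ _))
  rintro _ ⟨x, ⟨hx, hx1⟩, rfl⟩
  calc x z ≤ |x z| := le_abs_self _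
    _ ≤ C * ‖x‖ := hC ⟨z, hz⟩ x hx
    _ ≤ max C 0 * 1 := by
        gcongr
        exact le_max_left _ _
    _ = max C 0 := mul_one _

end

/-! ### Scalar densities of a vector measure -/

section

variable {Z : Type*} [NormedAddCommGroup Z] [NormedSpace ℝ Z]
  {Ω : Type*} [MeasurableSpace Ω] {μ : Measure Ω}

/-- `T` maps `z` to the density of the scalar measure `A ↦ ⟨z, ν A⟩`. -/
def IsDensityMap (μ : Measure Ω) (ν : VectorMeasure Ω (StrongDual ℝ Z))
    (T : Z →L[ℝ] Lp ℝ 1 μ) : Prop :=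
  ∀ z A, MeasurableSet A → ∫ ω in A, T z ω ∂μ = ν A z

theorem exists_density [IsFiniteMeasure μ] {ν : VectorMeasure Ω (StrongDual ℝ Z)}
    (hν : IsContinuousWrt ν μ) (z : Z) :
    ∃ f : Lp ℝ 1 μ, ∀ A, MeasurableSet A → ∫ ω in A, f ω ∂μ = ν A z := by
  let s : SignedMeasure Ω := ν.mapRange
    (ContinuousLinearMap.apply ℝ ℝ z : StrongDual ℝ Z →L[ℝ] ℝ).toLinearMap.toAddMonoidHom
    (ContinuousLinearMap.apply ℝ ℝ z : StrongDual ℝ Z →L[ℝ] ℝ).continuous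
  have hs : ∀ A, s A = ν A z := fun A => rfl
  have hac : s ≪ᵥ μ.toENNRealVectorMeasure := by
    refine VectorMeasure.AbsolutelyContinuous.mk fun A hA h0 => ?_
    rw [Measure.toENNRealVectorMeasure_apply_measurable hA] at h0
    have hz : ν A = 0 := by
      rw [← norm_le_zero_iff]
      refine le_of_forall_pos_lt_add fun ε hε => ?_
      obtain ⟨δ, hδ, h⟩ := hν ε hε
      rw [zero_add]
      exact h A hA (by simpa [Measure.real, h0] using hδ)
    rw [hs, hz, zero_apply]
  rw [SignedMeasure.absolutelyContinuous_iff_withDensityᵥ_rnDeriv_eq] at hac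
  have hint := SignedMeasure.integrable_rnDeriv s μ
  refine ⟨hint.toL1 _, fun A hA => ?_⟩
  rw [← hs, ← DFunLike.congr_fun hac A, withDensityᵥ_apply hint hA]
  exact setIntegral_congr_ae hA (hint.coeFn_toL1.mono fun ω h _ => h)

theorem Lp_ext_of_setIntegral_eq {f g : Lp ℝ 1 μ}
    (h : ∀ A, MeasurableSet A → ∫ ω in A, f ω ∂μ = ∫ ω in A, g ω ∂μ) : f = g :=
  Lp.ext (Integrable.ae_eq_of_forall_setIntegral_eq _ _ (L1.integrable_coeFn f)
    (L1.integrable_coeFn g) fun A hA _ => h A hA)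

theorem exists_isDensityMap [IsFiniteMeasure μ] [CompleteSpace Z]
    {ν : VectorMeasure Ω (StrongDual ℝ Z)} (hν : IsContinuousWrt ν μ) :
    ∃ T : Z →L[ℝ] Lp ℝ 1 μ, IsDensityMap μ ν T := by
  choose D hD using exists_density (μ := μ) hν
  let L : Z →ₗ[ℝ] Lp ℝ 1 μ :=
    { toFun := D
      map_add' := fun y z => Lp_ext_of_setIntegral_eq fun A hA => by
        rw [setIntegral_congr_ae hA ((Lp.coeFn_add (D y) (D z)).mono fun ω h _ => h)]
        simp only [Pi.add_apply]
        rw [integral_add (L1.integrable_coeFn _).integrableOn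
          (L1.integrable_coeFn _).integrableOn, hD _ A hA, hD _ A hA, hD _ A hA, map_add]
      map_smul' := fun c z => Lp_ext_of_setIntegral_eq fun A hA => by
        rw [RingHom.id_apply,
          setIntegral_congr_ae hA ((Lp.coeFn_smul c (D z)).mono fun ω h _ => h)]
        simp only [Pi.smul_apply]
        rw [integral_smul, hD _ A hA, hD _ A hA, map_smul] }
  -- Closed graph theorem: an `L¹` limit of densities is identified through its integrals over
  -- measurable sets.
  have hL : Continuous L := by
    refine L.continuous_of_seq_closed_graph fun u z f hu hf =>
      Lp_ext_of_setIntegral_eq fun A hA => ?_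
    have h1 := ((continuous_setIntegral (μ := μ) A).tendsto f).comp hf
    have h2 : Tendsto (fun n => ν A (u n)) atTop (𝓝 (ν A z)) :=
      ((ν A).continuous.tendsto z).comp hu
    have h3 : ∫ ω in A, L z ω ∂μ = ν A z := hD z A hA
    rw [h3]
    refine tendsto_nhds_unique h1 (h2.congr fun n => ?_)
    exact (hD (u n) A hA).symm
  exact ⟨⟨L, hL⟩, hD⟩

variable {ν : VectorMeasure Ω (StrongDual ℝ Z)} {T : Z →L[ℝ] Lp ℝ 1 μ}

/-- Splitting `A` by the sign of `T z` writes `∫_A |T z|` as a difference of two values of `ν` on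
subsets of `A`, both small by `μ`-continuity. -/
theorem IsDensityMap.uniformIntegrable (hT : IsDensityMap μ ν T) [IsFiniteMeasure μ]
    (hν : IsContinuousWrt ν μ) {M : ℝ} (hM : 0 ≤ M) {ε : ℝ} (hε : 0 < ε) :
    ∃ δ : ℝ, 0 < δ ∧ ∀ z : Z, ‖z‖ ≤ M → ∀ A : Set Ω, MeasurableSet A → μ.real A < δ →
      ∫ ω in A, |T z ω| ∂μ ≤ ε := by
  obtain ⟨δ, hδ, h⟩ := hν (ε / (2 * (M + 1))) (by positivity)
  refine ⟨δ, hδ, fun z hz A hA hAδ => ?_⟩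
  have hi : Integrable (T z) μ := L1.integrable_coeFn _
  set P : Set Ω := {ω | 0 ≤ T z ω} with hP
  have hPm : MeasurableSet P :=
    measurableSet_le measurable_const (Lp.stronglyMeasurable (T z)).measurable
  have hbound : ∀ B ⊆ A, MeasurableSet B → |ν B z| ≤ ε / 2 := by
    intro B hBA hB
    have hB' := h B hB ((measureReal_mono hBA).trans_lt hAδ)
    calc |ν B z| ≤ ‖ν B‖ * ‖z‖ := (ν B).le_opNorm z
      _ ≤ ε / (2 * (M + 1)) * (M + 1) := by gcongr; linarith
      _ = ε / 2 := by field_simp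
  have h1 : ∫ ω in A ∩ P, |T z ω| ∂μ = ν (A ∩ P) z := by
    rw [← hT z _ (hA.inter hPm)]
    exact setIntegral_congr_fun (hA.inter hPm) fun ω hω => abs_of_nonneg hω.2
  have h2 : ∫ ω in A \ P, |T z ω| ∂μ = -ν (A \ P) z := by
    rw [← hT z _ (hA.diff hPm), ← integral_neg]
    exact setIntegral_congr_fun (hA.diff hPm) fun ω hω => abs_of_neg (not_le.1 hω.2)
  rw [← integral_inter_add_sdiff hPm hi.abs.integrableOn, h1, h2]
  have h3 := hbound _ Set.inter_subset_left (hA.inter hPm)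
  have h4 := hbound _ Set.sdiff_subset (hA.diff hPm)
  linarith [(abs_le.1 h3).2, (abs_le.1 h4).1]

/-- A functional in the weak-star closed convex hull of the average range of `ν` on `A` is bounded
above at `z` by any essential upper bound of the density of `z` on `A`. -/
theorem IsDensityMap.apply_le [IsFiniteMeasure μ] (hT : IsDensityMap μ ν T) {A : Set Ω}
    {x : StrongDual ℝ Z}
    (hx : StrongDual.toWeakDual x ∈
      closure ((StrongDual.toWeakDual : StrongDual ℝ Z → WeakDual ℝ Z) ''
        convexHull ℝ (averageRange μ ν A)))
    {z : Z} {p : ℝ} (hp : ∀ᵐ ω ∂μ, ω ∈ A → T z ω ≤ p) : x z ≤ p := by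
  have hcl : IsClosed {y : WeakDual ℝ Z | y z ≤ p} :=
    isClosed_le (WeakDual.eval_continuous z) continuous_const
  refine closure_minimal ?_ hcl hx
  rintro _ ⟨y, hy, rfl⟩
  have hconv : Convex ℝ {y : StrongDual ℝ Z | y z ≤ p} :=
    convex_halfSpace_le (f := fun y : StrongDual ℝ Z => y z)
      ⟨fun _ _ => rfl, fun _ _ => rfl⟩ p
  refine convexHull_min ?_ hconv hy
  rintro _ ⟨B, hB, hBA, hμ, rfl⟩
  have hpos : 0 < μ.real B := ENNReal.toReal_pos hμ.ne' (measure_ne_top _ _)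
  change (μ.real B)⁻¹ * ν B z ≤ p
  rw [inv_mul_le_iff₀ hpos, ← hT z B hB]
  calc ∫ ω in B, T z ω ∂μ ≤ ∫ _ in B, p ∂μ := by
        refine setIntegral_mono_on_ae (L1.integrable_coeFn _).integrableOn
          (integrable_const p).integrableOn hB ?_
        filter_upwards [hp] with ω h hω using h (hBA hω)
    _ = μ.real B * p := by simp

theorem IsDensityMap.le_apply [IsFiniteMeasure μ] (hT : IsDensityMap μ ν T) {A : Set Ω}
    {x : StrongDual ℝ Z}
    (hx : StrongDual.toWeakDual x ∈
      closure ((StrongDual.toWeakDual : StrongDual ℝ Z → WeakDual ℝ Z) ''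
        convexHull ℝ (averageRange μ ν A)))
    {z : Z} {p : ℝ} (hp : ∀ᵐ ω ∂μ, ω ∈ A → p ≤ T z ω) : p ≤ x z := by
  have h := hT.apply_le hx (z := -z) (p := -p) (by
    rw [map_neg]
    filter_upwards [hp, Lp.coeFn_neg (T z)] with ω h1 h2 hω
    rw [h2, Pi.neg_apply]
    exact neg_le_neg (h1 hω))
  rw [map_neg] at h
  exact neg_le_neg_iff.1 h

/-- Two distinct elements of `L¹` are separated by a gap on a set of positive measure. -/
theorem exists_gap_of_ne {f g : Lp ℝ 1 μ} (h : f ≠ g) :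
    ∃ A, MeasurableSet A ∧ 0 < μ A ∧ ∃ p q : ℝ, p < q ∧
      ((∀ ω ∈ A, f ω ≤ p ∧ q ≤ g ω) ∨ (∀ ω ∈ A, g ω ≤ p ∧ q ≤ f ω)) := by
  by_contra! hcon
  have hf := (Lp.stronglyMeasurable f).measurable
  have hg := (Lp.stronglyMeasurable g).measurable
  have hnull : ∀ u v : Ω → ℝ, Measurable u → Measurable v →
      (∀ p q : ℝ, p < q → μ {ω | u ω ≤ p ∧ q ≤ v ω} = 0) → ∀ᵐ ω ∂μ, v ω ≤ u ω := by
    intro u v _ _ h0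
    -- Rational levels leave only countably many null sets to discard.
    have : ∀ᵐ ω ∂μ, ∀ p q : ℚ, p < q → ¬(u ω ≤ p ∧ (q : ℝ) ≤ v ω) := by
      simp only [ae_all_iff]
      intro p q hpq
      rw [ae_iff]
      simpa using h0 p q (by exact_mod_cast hpq)
    filter_upwards [this] with ω hω
    by_contra! hlt
    obtain ⟨p, hp1, hp2⟩ := exists_rat_btwn hlt
    obtain ⟨q, hq1, hq2⟩ := exists_rat_btwn hp2
    exact hω p q (by exact_mod_cast hq1) ⟨hp1.le, hq2.le⟩
  have hms : ∀ (u v : Ω → ℝ), Measurable u → Measurable v → ∀ p q : ℝ,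
      MeasurableSet {ω | u ω ≤ p ∧ q ≤ v ω} := fun u v hu hv p q =>
    (measurableSet_le hu measurable_const).inter (measurableSet_le measurable_const hv)
  refine h (Lp.ext ?_)
  have h1 := hnull f g hf hg fun p q hpq => by
    by_contra h0
    obtain ⟨⟨ω, hω, hω'⟩, -⟩ := hcon _ (hms f g hf hg p q) (pos_iff_ne_zero.2 h0) p q hpq
    exact absurd hω.2 (not_le.2 (hω' hω.1))
  have h2 := hnull g f hg hf fun p q hpq => by
    by_contra h0
    obtain ⟨-, ⟨ω, hω, hω'⟩⟩ := hcon _ (hms g f hg hf p q) (pos_iff_ne_zero.2 h0) p q hpq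
    exact absurd hω.2 (not_le.2 (hω' hω.1))
  filter_upwards [h1, h2] with ω a b using le_antisymm b a

end

/-! ### Limits of densities under condition (G) -/

section

variable {Z : Type*} [NormedAddCommGroup Z] [NormedSpace ℝ Z]
  {Ω : Type*} [MeasurableSpace Ω] {μ : Measure Ω} [IsFiniteMeasure μ]
  {ν : VectorMeasure Ω (StrongDual ℝ Z)} {T : Z →L[ℝ] Lp ℝ 1 μ}
  {X : Submodule ℝ (StrongDual ℝ Z)}

/-- Under condition (G) the density map has a closed graph from `σ(Z, X)` to the norm of `L¹`, for
sequences. -/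
theorem IsDensityMap.eq_of_tendsto_sigma (hT : IsDensityMap μ ν T) (hG : ConditionG μ ν X)
    {h : ℕ → Z} {l : Z} (hl : Tendsto h atTop (@nhds Z (sigmaTopology X) l))
    {F : Lp ℝ 1 μ} (hF : Tendsto (fun n => T (h n)) atTop (𝓝 F)) : F = T l := by
  by_contra hne
  obtain ⟨A, hA, hμA, p, q, hpq, hgap⟩ := exists_gap_of_ne hne
  obtain ⟨ns, hns, hae⟩ := (tendstoInMeasure_of_tendsto_Lp hF).exists_seq_tendsto_ae
  have hApos : 0 < μ.real A := ENNReal.toReal_pos hμA.ne' (measure_ne_top _ _)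
  -- Egorov, discarding at most half of `A`: on the rest the densities obey pointwise bounds, which
  -- the functional from (G) on `A \ t` turns into bounds on `x (h (ns n))`.
  obtain ⟨t, htA, ht, htμ, hunif⟩ := tendstoUniformlyOn_of_ae_tendsto
    (f := fun n => (T (h (ns n)) : Ω → ℝ)) (g := F)
    (fun n => Lp.stronglyMeasurable _) (Lp.stronglyMeasurable F) hA
    (measure_ne_top μ A) (hae.mono fun ω hω _ => hω) (half_pos hApos)
  have hpos : 0 < μ (A \ t) := by
    rw [pos_iff_ne_zero]
    intro h0
    have h1 : μ.real A ≤ μ.real t + μ.real (A \ t) := by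
      rw [← measureReal_union Set.disjoint_sdiff_right (hA.diff ht),
        Set.union_sdiff_cancel htA]
    have h2 : μ.real t ≤ μ.real A / 2 :=
      ENNReal.toReal_le_of_le_ofReal (half_pos hApos).le htμ
    have h3 : μ.real (A \ t) = 0 := by simp [Measure.real, h0]
    linarith
  obtain ⟨x, hxX, hx⟩ := hG _ (hA.diff ht) hpos
  have hlim : Tendsto (fun n => x (h (ns n))) atTop (𝓝 (x l)) :=
    (tendsto_apply_sigma X hxX l).comp (hl.comp hns.tendsto_atTop)
  -- Half the gap: bounds on `F` by `p` or `q` become bounds on the approximating densities by `(p +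
  -- q) / 2`, still strictly on the wrong side of `T l`.
  have hev := Metric.tendstoUniformlyOn_iff.1 hunif ((q - p) / 2) (by linarith)
  simp only [Real.dist_eq, abs_lt] at hev
  rcases hgap with hgap | hgap
  · have h1 : x l ≤ (p + q) / 2 := by
      refine le_of_tendsto hlim (hev.mono fun n hn => hT.apply_le hx ?_)
      refine Eventually.of_forall fun ω hω => ?_
      linarith [(hn ω hω).1, (hgap ω hω.1).1]
    have h2 : q ≤ x l :=
      hT.le_apply hx (Eventually.of_forall fun ω hω => (hgap ω hω.1).2)
    linarith
  · have h1 : (p + q) / 2 ≤ x l := by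
      refine ge_of_tendsto hlim (hev.mono fun n hn => hT.le_apply hx ?_)
      refine Eventually.of_forall fun ω hω => ?_
      linarith [(hn ω hω).2, (hgap ω hω.1).2]
    have h2 : x l ≤ p :=
      hT.apply_le hx (Eventually.of_forall fun ω hω => (hgap ω hω.1).1)
    linarith

/-- Minimising `sqrtEnergy` along convex neighbourhoods yields a finer filter along which the
densities converge in `L¹`. -/
theorem IsDensityMap.exists_filter_tendsto (hT : IsDensityMap μ ν T) (hν : IsContinuousWrt ν μ)
    {C : Set Z} (hC : Convex ℝ C) {M : ℝ} (hM0 : 0 ≤ M) (hM : ∀ z ∈ C, ‖z‖ ≤ M) {z₀ : Z}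
    (hN : (@nhds Z (sigmaTopology X) z₀ ⊓ 𝓟 C).NeBot) :
    ∃ ℱ : Filter Z, ℱ.NeBot ∧ ℱ ≤ @nhds Z (sigmaTopology X) z₀ ⊓ 𝓟 C ∧
      ∃ G : Lp ℝ 1 μ, Tendsto T ℱ (𝓝 G) := by
  set N := @nhds Z (sigmaTopology X) z₀ ⊓ 𝓟 C with hNdef
  set J : Z → ℝ := fun z => sqrtEnergy (T z) with hJ
  have hNC : ∀ᶠ z in N, z ∈ C := mem_inf_of_right (mem_principal_self C)
  have hTle : ∀ z ∈ C, ‖T z‖ ≤ ‖T‖ * M := fun z hz =>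
    (T.le_opNorm z).trans (by gcongr; exact hM z hz)
  have hbelow : IsBoundedUnder (· ≥ ·) N J :=
    isBoundedUnder_of_eventually_ge (a := 0) (Eventually.of_forall fun z => sqrtEnergy_nonneg _)
  have habove : IsBoundedUnder (· ≤ ·) N J :=
    isBoundedUnder_of_eventually_le (a := μ.real Set.univ + ‖T‖ * M)
      (hNC.mono fun z hz => (sqrtEnergy_le _).trans (by gcongr; exact hTle z hz))
  set m := liminf J N
  have hlow : ∀ δ > 0, ∀ᶠ z in N, m - δ < J z := fun δ hδ =>
    eventually_lt_of_lt_liminf (by change m - δ < m; linarith) hbelow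
  have hfreq : ∀ δ > 0, ∃ᶠ z in N, J z < m + δ := fun δ hδ =>
    frequently_lt_of_liminf_lt habove.isCoboundedUnder_ge (by change m < m + δ; linarith)
  have hne : (N ⊓ comap J (𝓝 m)).NeBot := by
    rw [inf_neBot_iff]
    rintro s hs s' ⟨V, hV, hVs⟩
    obtain ⟨δ, hδ, hball⟩ := Metric.mem_nhds_iff.1 hV
    obtain ⟨z, hz1, hz2, hz3⟩ := ((hfreq δ hδ).and_eventually ((hlow δ hδ).and hs)).exists
    refine ⟨z, hz3, hVs (hball ?_)⟩
    rw [Metric.mem_ball, Real.dist_eq, abs_lt]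
    constructor <;> linarith
  refine ⟨N ⊓ comap J (𝓝 m), hne, inf_le_left, ?_⟩
  suffices hcauchy : Cauchy (map T (N ⊓ comap J (𝓝 m))) from
    CompleteSpace.complete hcauchy
  rw [Metric.cauchy_iff]
  refine ⟨hne.map T, fun ε hε => ?_⟩
  obtain ⟨δ, hδ, hmod⟩ := exists_sqrtEnergy_modulus (μ := μ) (S := T '' C) (M := ‖T‖ * M)
    (by rintro _ ⟨z, hz, rfl⟩; exact hTle z hz)
    (fun ε hε => by
      obtain ⟨δ, hδ, h⟩ := hT.uniformIntegrable hν hM0 hε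
      refine ⟨δ, hδ, ?_⟩
      rintro _ ⟨z, hz, rfl⟩
      exact h z (hM z hz)) (half_pos hε)
  -- Convexity of `U` keeps midpoints above `m - δ / 4`; with both endpoints below `m + δ / 4`, the
  -- convexity deficit is less than `δ`.
  obtain ⟨U, hU, hUconv, hUs⟩ :=
    exists_convex_nhds_sigma X (mem_inf_principal.1 (hlow (δ / 4) (by positivity)))
  have hUC : U ∩ C ∈ N := inter_mem_inf hU (mem_principal_self C)
  have hJlt : {z | J z < m + δ / 4} ∈ comap J (𝓝 m) :=
    preimage_mem_comap (Iio_mem_nhds (by linarith))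
  refine ⟨T '' ((U ∩ C) ∩ {z | J z < m + δ / 4}), image_mem_map (inter_mem_inf hUC hJlt), ?_⟩
  rintro _ ⟨y, ⟨hy, hyJ⟩, rfl⟩ _ ⟨z, ⟨hz, hzJ⟩, rfl⟩
  have hmid : (2⁻¹ : ℝ) • (y + z) ∈ U ∩ C := by
    rw [smul_add]
    exact (hUconv.inter hC) hy hz (by norm_num) (by norm_num) (by norm_num)
  have hmidJ : m - δ / 4 < J ((2⁻¹ : ℝ) • (y + z)) := hUs hmid.1 hmid.2
  rw [dist_eq_norm]
  refine (hmod _ ⟨y, hy.2, rfl⟩ _ ⟨z, hz.2, rfl⟩ ?_).trans_lt (half_lt_self hε)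
  rw [← map_add, ← map_smul]
  change J y + J z - 2 * J ((2⁻¹ : ℝ) • (y + z)) ≤ δ
  have hyJ' : J y < m + δ / 4 := hyJ
  have hzJ' : J z < m + δ / 4 := hzJ
  linarith

/-- The limit of the densities is the density of the `σ(Z, X)`-limit point. -/
theorem IsDensityMap.eq_of_tendsto_filter (hT : IsDensityMap μ ν T) (hG : ConditionG μ ν X)
    {S : Set Z} (hS : IsRelConvexBlockCompact (sigmaTopology X) S) {z₀ : Z} {ℱ : Filter Z}
    [ℱ.NeBot] (hℱ : ℱ ≤ @nhds Z (sigmaTopology X) z₀) (hℱS : S ∈ ℱ) {F : Lp ℝ 1 μ}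
    (hF : Tendsto T ℱ (𝓝 F)) : F = T z₀ := by
  by_contra hne
  obtain ⟨A, hA, hμA, p, q, hpq, hgap⟩ := exists_gap_of_ne hne
  obtain ⟨x, hxX, hx⟩ := hG A hA hμA
  have hxlim : Tendsto (fun z => x z) ℱ (𝓝 (x z₀)) := (tendsto_apply_sigma X hxX z₀).mono_left hℱ
  -- The block limit `l` need not be `z₀`. Tracking this one functional `x` is enough, since it
  -- detects the gap between the densities on `A`.
  have hex : ∀ n : ℕ, ∃ z ∈ S, dist (T z) F < 1 / (n + 1) ∧ dist (x z) (x z₀) < 1 / (n + 1) :=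
    fun n => by
      have hn : (0 : ℝ) < 1 / (n + 1) := by positivity
      obtain ⟨z, h1, h2, h3⟩ := (((eventually_mem_set.2 hℱS).and
        ((Metric.tendsto_nhds.1 hF _ hn).and (Metric.tendsto_nhds.1 hxlim _ hn)))).exists
      exact ⟨z, h1, h2, h3⟩
  choose g hgS hgT hgx using hex
  have hTg : Tendsto (fun n => T (g n)) atTop (𝓝 F) :=
    tendsto_iff_dist_tendsto_zero.2 (squeeze_zero (fun _ => dist_nonneg) (fun n => (hgT n).le)
      tendsto_one_div_add_atTop_nhds_zero_nat)
  have hxg : Tendsto (fun n => x (g n)) atTop (𝓝 (x z₀)) :=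
    tendsto_iff_dist_tendsto_zero.2 (squeeze_zero (fun _ => dist_nonneg) (fun n => (hgx n).le)
      tendsto_one_div_add_atTop_nhds_zero_nat)
  obtain ⟨h, hb, l, hl⟩ := hS g hgS
  have hTl : F = T l :=
    hT.eq_of_tendsto_sigma hG hl ((hb.map (T : Z →ₗ[ℝ] Lp ℝ 1 μ)).tendsto hTg)
  have hxl : x z₀ = x l :=
    tendsto_nhds_unique ((hb.map (x : Z →ₗ[ℝ] ℝ)).tendsto hxg)
      ((tendsto_apply_sigma X hxX l).comp hl)
  subst hTl
  rcases hgap with hgap | hgap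
  · have h1 := hT.apply_le hx (Eventually.of_forall fun ω hω => (hgap ω hω).1)
    have h2 := hT.le_apply hx (Eventually.of_forall fun ω hω => (hgap ω hω).2)
    linarith
  · have h1 := hT.apply_le hx (Eventually.of_forall fun ω hω => (hgap ω hω).1)
    have h2 := hT.le_apply hx (Eventually.of_forall fun ω hω => (hgap ω hω).2)
    linarith

/-- A convex subset on which `s * ν B` exceeds its value at `z₀` by `ε` does not have `z₀` in its
`σ(Z, X)`-closure. -/
theorem IsDensityMap.not_frequently_add_le (hT : IsDensityMap μ ν T) (hν : IsContinuousWrt ν μ)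
    (hG : ConditionG μ ν X) {S : Set Z} (hSc : Convex ℝ S)
    (hS : IsRelConvexBlockCompact (sigmaTopology X) S) {M : ℝ} (hM0 : 0 ≤ M)
    (hM : ∀ z ∈ S, ‖z‖ ≤ M) {B : Set Ω} (hB : MeasurableSet B) (s : ℝ) {ε : ℝ} (hε : 0 < ε)
    (z₀ : Z) :
    ¬ (@nhds Z (sigmaTopology X) z₀ ⊓ 𝓟 (S ∩ {z | ε ≤ s * (ν B z - ν B z₀)})).NeBot := by
  intro hN
  -- A half-space of the linear functional `s • ν B`, so the energy minimisation can take place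
  -- inside it.
  have hconv : Convex ℝ {z : Z | ε ≤ s * (ν B z - ν B z₀)} := by
    have := convex_halfSpace_ge (f := fun z : Z => (s • ν B) z)
      ⟨fun _ _ => map_add _ _ _, fun _ _ => map_smul _ _ _⟩ (ε + s * ν B z₀)
    convert this using 3 with z
    change _ ↔ ε + s * ν B z₀ ≤ s * ν B z
    constructor <;> intro h <;> linarith
  obtain ⟨ℱ, hne, hle, F, hF⟩ :=
    hT.exists_filter_tendsto hν (hSc.inter hconv) hM0 (fun z hz => hM z hz.1) hN
  have hmem : S ∩ {z | ε ≤ s * (ν B z - ν B z₀)} ∈ ℱ := le_principal_iff.1 (hle.trans inf_le_right)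
  have hFz : F = T z₀ := hT.eq_of_tendsto_filter hG hS (hle.trans inf_le_left)
    (mem_of_superset hmem Set.inter_subset_left) hF
  subst hFz
  have hlim : Tendsto (fun z => ν B z) ℱ (𝓝 (ν B z₀)) := by
    have := ((continuous_setIntegral (μ := μ) B).tendsto (T z₀)).comp hF
    rw [hT z₀ B hB] at this
    exact this.congr fun z => hT z B hB
  have hlim' : Tendsto (fun z => s * (ν B z - ν B z₀)) ℱ (𝓝 (s * (ν B z₀ - ν B z₀))) :=
    (hlim.sub_const _).const_mul s
  have := ge_of_tendsto hlim' (mem_of_superset hmem Set.inter_subset_right)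
  simp only [sub_self, mul_zero] at this
  linarith

end

theorem theorem6 {Ω : Type*} [MeasurableSpace Ω] (μ : Measure Ω) [IsFiniteMeasure μ]
    {Z : Type*} [NormedAddCommGroup Z] [NormedSpace ℝ Z] [CompleteSpace Z]
    (X : Submodule ℝ (StrongDual ℝ Z)) (hXclosed : IsClosed (X : Set (StrongDual ℝ Z)))
    (hXnorming : IsNorming X)
    (ν : VectorMeasure Ω (StrongDual ℝ Z)) (hν : IsContinuousWrt ν μ)
    (hG : ConditionG μ ν X)
    (K : Set Z) (hK : IsRelConvexBlockCompact (sigmaTopology X) (convexHull ℝ K)) :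
    ∀ B : Set Ω, MeasurableSet B →
      @Continuous K ℝ (TopologicalSpace.induced (Subtype.val : K → Z) (sigmaTopology X))
        _ (fun z : K => ν B (z : Z)) := by
  intro B hB
  obtain ⟨M, hM0, hM⟩ := hK.exists_norm_le hXclosed hXnorming
  obtain ⟨T, hT⟩ := exists_isDensityMap (μ := μ) hν
  refine (@continuous_iff_continuousAt K ℝ
    (TopologicalSpace.induced Subtype.val (sigmaTopology X)) _ _).2 fun z₀ => ?_
  change Tendsto (fun z : K => ν B (z : Z))
    (@nhds K (TopologicalSpace.induced Subtype.val (sigmaTopology X)) z₀) (𝓝 (ν B z₀))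
  rw [@nhds_induced Z K (sigmaTopology X), Metric.tendsto_nhds]
  intro ε hε
  -- The set `|ν B z - ν B z₀| ≥ ε` is not convex in general; `s = 1` and `s = -1` treat its two
  -- half-spaces separately.
  have key := fun s : ℝ =>
    hT.not_frequently_add_le hν hG (convex_convexHull ℝ K) hK hM0 hM hB s hε z₀
  simp only [not_neBot, inf_principal_eq_bot] at key
  filter_upwards [preimage_mem_comap (key 1), preimage_mem_comap (key (-1))] with z h1 h2
  have hz := subset_convexHull ℝ K z.2
  have h1' : ¬ ε ≤ 1 * (ν B z - ν B z₀) := fun h => h1 ⟨hz, h⟩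
  have h2' : ¬ ε ≤ -1 * (ν B z - ν B z₀) := fun h => h2 ⟨hz, h⟩
  rw [Real.dist_eq, abs_lt]
  constructor <;> linarith
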